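/- **Setting.** Let $A\in\mathbb{R}^{m\times n}$, $b\in\mathbb{R}^m$ be such that $Q=\{x\in\mathbb{R}^n : Ax\le b\}$ is nonempty and bounded, and let $\psi:\mathbb{R}^n\to(-\infty,\infty]$ be a proper convex function with effective domain $\mathrm{dom}\,\psi=\{\psi<\infty\}$. Let $g\sim\mathcal N(0,I_n)$ be a standard Gaussian vector. Consider the linear program $P_0$: minimize $-g\cdot x$ over $x\in Q$, and, for $\varepsilon\ge 0$, the regularized program $P_\varepsilon$: minimize $-g\cdot x+(\varepsilon\psi)(x)$ over $x\in Q$, where for $\varepsilon=0$ the function $(\varepsilon\psi)$ is taken to be the $\{0,\infty\}$-valued indicator function of $\mathrm{dom}\,\psi$. Write $\mathrm{Sol}(\cdot)$ for the solution set; in $\mathrm{Sol}(P_{\varepsilon'})$ below the regularized program is meant also for $\varepsilon'=0$. - $\mathrm{ER}(\varepsilon)$ is the event that $P_0$ has a unique solution and this solution also solves $P_\varepsilon$; $\mathrm{ER}^c(\varepsilon)$ is its complement. - $\overline{\varepsilon}:=\sup\{\varepsilon\ge 0 : \mathrm{Sol}(P_{\varepsilon'})\subseteq\mathrm{Sol}(P_0)\text{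 for all }\varepsilon'\in[0,\varepsilon)\}\in[0,\infty]$. - $N(z)=\{v : v\cdot(y-z)\le 0\ \text{for all } y\in Q\}$ is the normal cone, $\partial\psi(z)$ is the subdifferential, and $\mathrm{vert}(Q)$ is the set of vertices of $Q$ (points $z$ such that $\{z\}$ is an exposed face). **Corollary (failure probability under the membership condition).** Suppose that $\mathrm{relint}(\mathrm{dom}\,\psi)\cap Q\neq\emptyset$ and that $\partial\psi(z)\cap N(z)\ne\emptyset$ for every $z\in\mathrm{vert}(Q)$. Choose any $v_z\in\partial\psi(z)\cap N(z)$ for each vertex $z$. Then the maximum $B=\max\{\|v_z\| : z\in\mathrm{vert}(Q)\}$ exists, for every $\varepsilon\ge0$ the set $\mathrm{ER}(\varepsilon)$ is an event (measurable up to a null set), and $$\mathbb{P}[\mathrm{ER}^c(\varepsilon)]\le 1-\exp\left(-\tfrac12\varepsilon^2B^2-\varepsilon B\sqrt n\right)\le \tfrac12\varepsilon^2B^2+\varepsilon B\sqrt n .$$ Moreover, $$\mathbb{E}\,\overline{\varepsilon}\ \ge\ \frac{1-e^{-4n}}{2B\sqrt n},$$ where the right-hand side is read as $+\infty$ if $B=0$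 and $n\geq 1$ (and as $0$ if $n=0$), and $\mathbb{E}$ is understood as a lower integral, which is the usual expectation if $\overline{\varepsilon}$ is measurable. **Application (quadratically regularized optimal transport).** Let $Q=\{X\in\mathbb{R}^{d\times d} : X\mathbf e=\mathbf e,\ X^T\mathbf e=\mathbf e,\ X\ge0\}$ be the Birkhoff polytope of doubly stochastic matrices, with $\mathbb{R}^{d\times d}$ identified with $\mathbb{R}^n$, $n=d^2$, and let $\psi=\frac12\|\cdot\|_F^2$, with $g$ standard Gaussian on $\mathbb{R}^{d\times d}$. Then for every $\varepsilon\ge0$ $$\mathbb{P}[\mathrm{ER}^c(\varepsilon)]\le 1-\exp\left(-\tfrac12\varepsilon^2\sqrt n-\varepsilon n^{3/4}\right)\le\tfrac12\varepsilon^2\sqrt n+\varepsilon n^{3/4}, \qquad \mathbb{E}\,\overline{\varepsilon}\ \ge\ \frac{1-e^{-4n}}{2n^{3/4}}$$ (with the last quotient read as $0$ if $n=0$). -/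

import Mathlib

open MeasureTheory ProbabilityTheory

noncomputable section

/-- The feasible region `{x | A x ≤ b}`. -/
def polyhedron {κ ι : Type*} [Fintype ι] (A : Matrix κ ι ℝ) (b : κ → ℝ) :
    Set (EuclideanSpace ℝ ι) :=
  {x | A.mulVec x.ofLp ≤ b}

/-- The normal cone to `Q` at `x`. -/
def normalCone {ι : Type*} [Fintype ι] (Q : Set (EuclideanSpace ℝ ι))
    (x : EuclideanSpace ℝ ι) : Set (EuclideanSpace ℝ ι) :=
  {v | ∀ y ∈ Q, inner ℝ v (y - x) ≤ 0}

/-- The vertices of `Q`: the points `z ∈ Q` such that `{z}` is an exposed face of `Q`. -/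
def vertices {ι : Type*} [Fintype ι] (Q : Set (EuclideanSpace ℝ ι)) :
    Set (EuclideanSpace ℝ ι) :=
  Q.exposedPoints ℝ

/-- The effective domain of an extended-real-valued function. -/
def effDom {E : Type*} (ψ : E → EReal) : Set E :=
  {x | ψ x < ⊤}

/-- `ψ` is a proper convex function with values in `(-∞, ∞]`: it never takes the value `-∞`,
is not identically `+∞`, and its epigraph is convex. -/
structure IsProperConvex {ι : Type*} [Fintype ι] (ψ : EuclideanSpace ℝ ι → EReal) : Prop where
  ne_bot : ∀ x, ψ x ≠ ⊥
  nonempty_effDom : (effDom ψ).Nonempty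
  convex_epigraph : Convex ℝ {p : EuclideanSpace ℝ ι × ℝ | ψ p.1 ≤ (p.2 : EReal)}

/-- The subdifferential `∂ψ(x)`. -/
def subdifferential {ι : Type*} [Fintype ι] (ψ : EuclideanSpace ℝ ι → EReal)
    (x : EuclideanSpace ℝ ι) : Set (EuclideanSpace ℝ ι) :=
  {v | ∀ y, ψ x + ((inner ℝ v (y - x) : ℝ) : EReal) ≤ ψ y}

open Classical in
/-- The function `εψ`, with the convention that `0ψ` is the indicator function of the effective
domain of `ψ` (with values `0` and `+∞`). -/
def scaledFun {E : Type*} (ε : ℝ) (ψ : E → EReal) (x : E) : EReal :=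
  if ε = 0 then (if x ∈ effDom ψ then 0 else ⊤) else (ε : EReal) * ψ x

/-- The solution set of the linear program `P₀`: minimize `-g · x` over `x ∈ Q`. -/
def lpSol {ι : Type*} [Fintype ι] (Q : Set (EuclideanSpace ℝ ι)) (g : EuclideanSpace ℝ ι) :
    Set (EuclideanSpace ℝ ι) :=
  {x | x ∈ Q ∧ IsMinOn (fun y => -(inner ℝ g y : ℝ)) Q x}

/-- The solution set of the regularized program `P_ε`: minimize `-g · x + (εψ)(x)` over `x ∈ Q`. -/
def regSol {ι : Type*} [Fintype ι] (Q : Set (EuclideanSpace ℝ ι))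
    (ψ : EuclideanSpace ℝ ι → EReal) (ε : ℝ) (g : EuclideanSpace ℝ ι) :
    Set (EuclideanSpace ℝ ι) :=
  {x | x ∈ Q ∧ IsMinOn (fun y => ((-(inner ℝ g y : ℝ) : ℝ) : EReal) + scaledFun ε ψ y) Q x}

/-- The cost vectors for which exact regularization `ER(ε)` occurs: `P₀` has a unique solution,
and this solution also solves `P_ε`. -/
def exactReg {ι : Type*} [Fintype ι] (Q : Set (EuclideanSpace ℝ ι))
    (ψ : EuclideanSpace ℝ ι → EReal) (ε : ℝ) : Set (EuclideanSpace ℝ ι) :=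
  {g | ∃ z, lpSol Q g = {z} ∧ z ∈ regSol Q ψ ε g}

/-- The regularization threshold: the supremum, in `[0, ∞]`, of all `ε ≥ 0` such that
`Sol(P_ε') ⊆ Sol(P₀)` for all `ε' ∈ [0, ε)`. -/
def regThreshold {ι : Type*} [Fintype ι] (Q : Set (EuclideanSpace ℝ ι))
    (ψ : EuclideanSpace ℝ ι → EReal) (g : EuclideanSpace ℝ ι) : ENNReal :=
  sSup (ENNReal.ofReal ''
    {ε : ℝ | 0 ≤ ε ∧ ∀ ε' ∈ Set.Ico 0 ε, regSol Q ψ ε' g ⊆ lpSol Q g})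

/-- The Birkhoff polytope of doubly stochastic `d × d` matrices, where the space of matrices is
identified with the Euclidean space of dimension `d²` (so the norm is the Frobenius norm). -/
def birkhoffPolytope (d : ℕ) : Set (EuclideanSpace ℝ (Fin d × Fin d)) :=
  {X | (∀ i, ∑ j, X (i, j) = 1) ∧ (∀ j, ∑ i, X (i, j) = 1) ∧ ∀ i j, 0 ≤ X (i, j)}

/-- The quadratic regularizer `½‖x‖²`. -/
def quadReg {ι : Type*} [Fintype ι] (x : EuclideanSpace ℝ ι) : EReal :=
  ((1 / 2 * ‖x‖ ^ 2 : ℝ) : EReal)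

end

/-! The support function of the compact set `Q` is Lipschitz, hence differentiable almost
everywhere, and where it is differentiable the linear program has exactly one solution, a vertex. So
the normal cones N(z) at the vertices tile the cost space up to null sets.

If g - εv_z lies in N(z), then so does g, because v_z does and N(z) is a convex cone; adding the
subgradient inequality for v_z shows that z also solves the regularized program. Exact
regularization therefore holds on the union of the shifted cones N(z) + εv_z, almost disjoint since
each lies in N(z). Shifting a Gaussian costs the factor exp(-ε²‖v_z‖²/2 - ε⟨x, v_z⟩) ≥ exp(-ε²B²/2 -
εB‖x‖). Summing over the vertices leaves the Gaussian mean of the last expression, which Jensen and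
E‖x‖ ≤ √n bound from below (`exp_le_stdGaussian_shiftedCosts`).

A cost in the shifted union for ε has threshold at least ε (`ofReal_le_regThreshold`), so
integrating the same bound over ε bounds the mean threshold. For the Birkhoff polytope take v_z = z
and B = √d. -/

/-! ### Gaussian density, shifts and moments. -/

section Gaussian

variable {E : Type*} [NormedAddCommGroup E] [InnerProductSpace ℝ E]

/-- The density of the standard Gaussian measure with respect to the volume. -/
noncomputable def stdGaussianDensity (x : E) : ℝ :=
  ((Real.pi / (1 / 2)) ^ (Module.finrank ℝ E / 2 : ℝ))⁻¹ * Real.exp (-(1 / 2) * ‖x‖ ^ 2)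

lemma stdGaussianDensity_nonneg (x : E) : 0 ≤ stdGaussianDensity x := by
  unfold stdGaussianDensity; positivity

lemma measurable_stdGaussianDensity [MeasurableSpace E] [BorelSpace E] :
    Measurable (stdGaussianDensity (E := E)) := by
  unfold stdGaussianDensity; fun_prop

lemma stdGaussianDensity_add (x a : E) :
    stdGaussianDensity (x + a) =
      stdGaussianDensity x * Real.exp (-(1 / 2) * ‖a‖ ^ 2 - inner ℝ x a) := by
  rw [stdGaussianDensity, stdGaussianDensity, mul_assoc, ← Real.exp_add, norm_add_sq_real]
  ring_nf

variable [FiniteDimensional ℝ E] [MeasurableSpace E] [BorelSpace E]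

lemma integrable_stdGaussianDensity : Integrable (stdGaussianDensity (E := E)) := by
  have h := GaussianFourier.integrable_cexp_neg_mul_sq_norm_add (V := E) (b := (1 / 2 : ℂ))
    (by norm_num) 0 0
  refine Integrable.const_mul ?_ _
  convert h.re using 2 with x
  rw [← RCLike.ofReal_re (K := ℂ) (Real.exp _)]
  congr 1
  simp

/-- Both measures are finite and have the same characteristic function, by the Gaussian Fourier
integral. -/
theorem stdGaussian_eq_withDensity :
    stdGaussian E = volume.withDensity fun x => ENNReal.ofReal (stdGaussianDensity x) := by
  have : IsFiniteMeasure
      ((volume : Measure E).withDensity fun x => ENNReal.ofReal (stdGaussianDensity x)) :=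
    isFiniteMeasure_withDensity_ofReal integrable_stdGaussianDensity.2
  refine Measure.ext_of_charFun ?_
  ext t
  rw [charFun_stdGaussian, charFun_apply, integral_withDensity_eq_integral_toReal_smul
    measurable_stdGaussianDensity.ennreal_ofReal (by simp)]
  have h := GaussianFourier.integral_cexp_neg_mul_sq_norm_add (V := E) (b := (1 / 2 : ℂ))
    (by norm_num) Complex.I t
  set K : ℝ := (Real.pi / (1 / 2)) ^ (Module.finrank ℝ E / 2 : ℝ) with hK
  have hK0 : (K : ℂ) ≠ 0 := by
    rw [Complex.ofReal_ne_zero]; positivity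
  have hKc : ((Real.pi : ℂ) / (1 / 2)) ^ (Module.finrank ℝ E / 2 : ℂ) = (K : ℂ) := by
    rw [hK, Complex.ofReal_cpow (by positivity)]
    push_cast; rfl
  rw [hKc] at h
  have h2 : (fun x : E => (ENNReal.ofReal (stdGaussianDensity x)).toReal •
      Complex.exp ((inner ℝ x t : ℝ) * Complex.I)) = fun x => (K : ℂ)⁻¹ *
      Complex.exp (-(1 / 2) * (‖x‖ : ℂ) ^ 2 + Complex.I * (inner ℝ t x : ℝ)) := by
    ext x
    rw [ENNReal.toReal_ofReal (stdGaussianDensity_nonneg x), stdGaussianDensity, ← hK,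
      Complex.exp_add, real_inner_comm, Complex.real_smul]
    push_cast
    rw [mul_assoc, mul_comm Complex.I]
  rw [h2, integral_const_mul, h, ← mul_assoc, inv_mul_cancel₀ hK0, one_mul]
  congr 1
  rw [Complex.I_sq]; ring

lemma stdGaussian_absolutelyContinuous : stdGaussian E ≪ volume := by
  rw [stdGaussian_eq_withDensity]; exact withDensity_absolutelyContinuous _ _

/-- Cameron–Martin formula: translate Lebesgue measure by `a` and take the quotient of the
densities. -/
lemma stdGaussian_preimage_sub_const (a : E) {s : Set E} (hs : MeasurableSet s) :
    stdGaussian E {x | x - a ∈ s} =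
      ∫⁻ x in s, ENNReal.ofReal (Real.exp (-(1 / 2) * ‖a‖ ^ 2 - inner ℝ x a)) ∂stdGaussian E := by
  have hs' : MeasurableSet {x : E | x - a ∈ s} := hs.preimage (measurable_id.sub_const a)
  have hρ := (measurable_stdGaussianDensity (E := E)).ennreal_ofReal
  rw [stdGaussian_eq_withDensity, withDensity_apply _ hs', restrict_withDensity hs,
    lintegral_withDensity_eq_lintegral_mul _ hρ (by fun_prop), ← lintegral_indicator hs',
    ← lintegral_indicator hs, ← lintegral_add_right_eq_self _ a]
  refine lintegral_congr fun x => ?_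
  by_cases hx : x ∈ s
  · rw [Set.indicator_of_mem (by simpa using hx), Set.indicator_of_mem hx, Pi.mul_apply,
      ← ENNReal.ofReal_mul (stdGaussianDensity_nonneg x), stdGaussianDensity_add]
  · rw [Set.indicator_of_notMem (by simpa using hx), Set.indicator_of_notMem hx]

lemma memLp_id_stdGaussian : MemLp id 2 (stdGaussian E) := IsGaussian.memLp_two_id

lemma integral_norm_sq_stdGaussian :
    ∫ x, ‖x‖ ^ 2 ∂stdGaussian E = Module.finrank ℝ E := by
  set b := stdOrthonormalBasis ℝ E
  have hmem (i) : MemLp (fun x => innerSL ℝ (b i) x) 2 (stdGaussian E) :=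
    (innerSL ℝ (b i)).comp_memLp' memLp_id_stdGaussian
  have h1 (i) : ∫ x, (inner ℝ (b i) x : ℝ) ^ 2 ∂stdGaussian E = 1 := by
    have := variance_dual_stdGaussian (innerSL ℝ (b i))
    rw [variance_of_integral_eq_zero (by fun_prop) (integral_strongDual_stdGaussian _)] at this
    simpa using this
  have h2 (i) : Integrable (fun x => (inner ℝ (b i) x : ℝ) ^ 2) (stdGaussian E) :=
    (hmem i).integrable_sq
  simp_rw [← b.sum_sq_inner_right]
  rw [integral_finsetSum _ fun i _ => h2 i]
  simp [h1]

/-- The variance of ‖x‖ is nonnegative. -/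
lemma integral_norm_stdGaussian_le :
    ∫ x, ‖x‖ ∂stdGaussian E ≤ √(Module.finrank ℝ E) := by
  have hi : Integrable (fun x : E => ‖x‖) (stdGaussian E) :=
    (memLp_id_stdGaussian.integrable (by norm_num)).norm
  refine Real.le_sqrt_of_sq_le ?_
  have h := variance_nonneg (fun x : E => ‖x‖) (stdGaussian E)
  rw [variance_eq_sub (X := fun x : E => ‖x‖) memLp_id_stdGaussian.norm] at h
  rw [← integral_norm_sq_stdGaussian (E := E)]
  simp only [Pi.pow_apply] at h
  linarith

lemma exp_le_lintegral_stdGaussian (a : ℝ) {c : ℝ} (hc : 0 ≤ c) :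
    ENNReal.ofReal (Real.exp (a - c * √(Module.finrank ℝ E))) ≤
      ∫⁻ x, ENNReal.ofReal (Real.exp (a - c * ‖x‖)) ∂stdGaussian E := by
  set r := √(Module.finrank ℝ E)
  have hi : Integrable (fun x : E => ‖x‖) (stdGaussian E) :=
    (memLp_id_stdGaussian.integrable (by norm_num)).norm
  have hb : Integrable (fun x : E => Real.exp (a - c * ‖x‖)) (stdGaussian E) := by
    refine Integrable.of_bound (C := Real.exp a) (by fun_prop) (ae_of_all _ fun x => ?_)
    rw [Real.norm_of_nonneg (Real.exp_pos _).le]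
    exact Real.exp_le_exp.2 (sub_le_self _ (by positivity))
  rw [← ofReal_integral_eq_lintegral_ofReal hb (ae_of_all _ fun x => (Real.exp_pos _).le)]
  refine ENNReal.ofReal_le_ofReal ?_
  -- Jensen by hand: bound the exponential below by its tangent at c‖x‖ = c * r.
  calc Real.exp (a - c * r)
      ≤ Real.exp (a - c * r) * (1 + c * r - c * ∫ x, ‖x‖ ∂stdGaussian E) := by
        refine le_mul_of_one_le_right (Real.exp_pos _).le ?_
        linarith [mul_le_mul_of_nonneg_left (integral_norm_stdGaussian_le (E := E)) hc]
    _ = ∫ x, Real.exp (a - c * r) * (1 + c * r - c * ‖x‖) ∂stdGaussian E := by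
        rw [integral_const_mul, integral_sub (integrable_const _) (hi.const_mul c),
          integral_const_mul]
        simp
    _ ≤ ∫ x, Real.exp (a - c * ‖x‖) ∂stdGaussian E := by
        refine integral_mono (((integrable_const _).sub (hi.const_mul c)).const_mul _) hb
          fun x => ?_
        have h : Real.exp (a - c * ‖x‖) = Real.exp (a - c * r) * Real.exp (c * r - c * ‖x‖) := by
          rw [← Real.exp_add]; ring_nf
        rw [h]
        refine mul_le_mul_of_nonneg_left ?_ (Real.exp_pos _).le
        linarith [Real.add_one_le_exp (c * r - c * ‖x‖)]

end Gaussian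

/-! ### Normal cones, generic uniqueness and exact regularization. -/

section Geometry

variable {ι : Type*} [Fintype ι] {Q : Set (EuclideanSpace ℝ ι)}
  {g v z : EuclideanSpace ℝ ι} {ψ : EuclideanSpace ℝ ι → EReal} {ε : ℝ}

/-- The support function of `Q`. -/
noncomputable def supportFun (Q : Set (EuclideanSpace ℝ ι)) (g : EuclideanSpace ℝ ι) : ℝ :=
  sSup ((fun y => inner ℝ g y) '' Q)

lemma bddAbove_inner_image (hQ : IsCompact Q) (g : EuclideanSpace ℝ ι) :
    BddAbove ((fun y => (inner ℝ g y : ℝ)) '' Q) :=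
  hQ.bddAbove_image (by fun_prop)

lemma inner_le_supportFun (hQ : IsCompact Q) (hz : z ∈ Q) : inner ℝ g z ≤ supportFun Q g :=
  le_csSup (bddAbove_inner_image hQ g) ⟨z, hz, rfl⟩

lemma mem_lpSol_iff : z ∈ lpSol Q g ↔ z ∈ Q ∧ ∀ y ∈ Q, (inner ℝ g y : ℝ) ≤ inner ℝ g z := by
  simp [lpSol, isMinOn_iff]

lemma mem_lpSol_iff_mem_normalCone (hz : z ∈ Q) : z ∈ lpSol Q g ↔ g ∈ normalCone Q z := by
  simp [mem_lpSol_iff, normalCone, hz, inner_sub_right]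

lemma lpSol_nonempty (hQ : IsCompact Q) (hne : Q.Nonempty) (g : EuclideanSpace ℝ ι) :
    (lpSol Q g).Nonempty :=
  let ⟨z, hz, h⟩ := hQ.exists_isMinOn hne
    (f := fun y => -(inner ℝ g y : ℝ)) (by fun_prop)
  ⟨z, hz, h⟩

lemma supportFun_eq (hQ : IsCompact Q) (hz : z ∈ lpSol Q g) : supportFun Q g = inner ℝ g z := by
  rw [mem_lpSol_iff] at hz
  refine le_antisymm (csSup_le ⟨_, z, hz.1, rfl⟩ ?_) (inner_le_supportFun hQ hz.1)
  rintro _ ⟨y, hy, rfl⟩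
  exact hz.2 y hy

/-- A maximizer for g competes for g', and its norm is bounded over `Q`. -/
lemma exists_lipschitzWith_supportFun (hQ : IsCompact Q) (hne : Q.Nonempty) :
    ∃ C, LipschitzWith C (supportFun Q) := by
  obtain ⟨C, hC⟩ := hQ.isBounded.exists_norm_le
  refine ⟨C.toNNReal, LipschitzWith.of_le_add_mul _ fun g g' => ?_⟩
  obtain ⟨z, hz⟩ := lpSol_nonempty hQ hne g
  have hzQ := (mem_lpSol_iff.1 hz).1
  rw [supportFun_eq hQ hz, dist_eq_norm]
  have h1 := inner_le_supportFun (g := g') hQ hzQ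
  have h2 : inner ℝ (g - g') z ≤ C.toNNReal * ‖g - g'‖ :=
    (real_inner_le_norm _ _).trans <| by
      rw [mul_comm]
      exact mul_le_mul_of_nonneg_right ((hC z hzQ).trans (Real.le_coe_toNNReal C)) (norm_nonneg _)
  rw [inner_sub_left] at h2
  linarith

/-- The cost vectors at which the support function is differentiable. -/
def smoothCosts (Q : Set (EuclideanSpace ℝ ι)) : Set (EuclideanSpace ℝ ι) :=
  {g | DifferentiableAt ℝ (supportFun Q) g}

lemma measurableSet_smoothCosts : MeasurableSet (smoothCosts Q) :=
  measurableSet_of_differentiableAt _ _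

lemma ae_mem_smoothCosts (hQ : IsCompact Q) (hne : Q.Nonempty) :
    ∀ᵐ g ∂stdGaussian (EuclideanSpace ℝ ι), g ∈ smoothCosts Q := by
  obtain ⟨C, hC⟩ := exists_lipschitzWith_supportFun hQ hne
  exact stdGaussian_absolutelyContinuous.ae_le hC.ae_differentiableAt

/-- The support function minus the linear function of z is nonnegative and vanishes at g, so g is a
critical point. The gradient thus determines the solution. -/
lemma fderiv_supportFun (hQ : IsCompact Q) (hg : g ∈ smoothCosts Q) (hz : z ∈ lpSol Q g) :
    fderiv ℝ (supportFun Q) g = innerSL ℝ z := by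
  have hmin : IsLocalMin (fun g' => supportFun Q g' - innerSL ℝ z g') g := by
    refine Filter.Eventually.of_forall fun g' => ?_
    simp only [innerSL_apply_apply]
    rw [supportFun_eq hQ hz, real_inner_comm, sub_self, sub_nonneg, real_inner_comm]
    exact inner_le_supportFun hQ (mem_lpSol_iff.1 hz).1
  exact sub_eq_zero.1
    (hmin.hasFDerivAt_eq_zero (hg.hasFDerivAt.sub (innerSL ℝ z).hasFDerivAt))

lemma lpSol_eq_singleton (hQ : IsCompact Q) (hg : g ∈ smoothCosts Q) (hz : z ∈ lpSol Q g) :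
    lpSol Q g = {z} := by
  refine Set.eq_singleton_iff_unique_mem.2 ⟨hz, fun y hy => ?_⟩
  have h := (fderiv_supportFun hQ hg hy).symm.trans (fderiv_supportFun hQ hg hz)
  exact (innerSL_inj (𝕜 := ℝ)).1 h

lemma inner_sub_neg_of_lpSol_eq (h : lpSol Q g = {z}) {y : EuclideanSpace ℝ ι} (hy : y ∈ Q)
    (hyz : y ≠ z) : inner ℝ g (y - z) < 0 := by
  have hz : z ∈ lpSol Q g := h ▸ rfl
  have hy' : y ∉ lpSol Q g := h ▸ hyz
  by_contra! hlt
  rw [inner_sub_right, sub_nonneg] at hlt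
  exact hy' (mem_lpSol_iff.2 ⟨hy, fun w hw => ((mem_lpSol_iff.1 hz).2 w hw).trans hlt⟩)

lemma mem_vertices_of_lpSol_eq (h : lpSol Q g = {z}) : z ∈ vertices Q := by
  have hz : z ∈ lpSol Q g := h ▸ rfl
  refine ⟨(mem_lpSol_iff.1 hz).1, innerSL ℝ g, fun y hy =>
    ⟨(mem_lpSol_iff.1 hz).2 y hy, fun hle => ?_⟩⟩
  by_contra hyz
  have := inner_sub_neg_of_lpSol_eq h hy hyz
  rw [inner_sub_right] at this
  simp only [innerSL_apply_apply] at hle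
  linarith

lemma isClosed_normalCone (Q : Set (EuclideanSpace ℝ ι)) (z : EuclideanSpace ℝ ι) :
    IsClosed (normalCone Q z) := by
  simp only [normalCone, Set.ofPred_forall]
  exact isClosed_iInter fun y => isClosed_iInter fun _ =>
    isClosed_le (by fun_prop) continuous_const

lemma mem_normalCone_of_sub_smul_mem (hε : 0 ≤ ε) (hv : v ∈ normalCone Q z)
    (h : g - ε • v ∈ normalCone Q z) : g ∈ normalCone Q z := fun y hy => by
  have h1 := h y hy
  have h2 := mul_nonpos_of_nonneg_of_nonpos hε (hv y hy)
  rw [inner_sub_left, real_inner_smul_left] at h1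
  linarith

/-- Handles ε = 0 and ε > 0 together. A subgradient at z forces ψ z to be finite, since otherwise ψ
would be infinite everywhere. -/
lemma exists_scaledFun_eq_coe (hbot : ∀ x, ψ x ≠ ⊥) (hdom : (effDom ψ).Nonempty) (hε : 0 ≤ ε)
    (hv : v ∈ subdifferential ψ z) :
    ∃ r : ℝ, scaledFun ε ψ z = r ∧
      ∀ y, ((r + ε * inner ℝ v (y - z) : ℝ) : EReal) ≤ scaledFun ε ψ y := by
  obtain ⟨x, hx⟩ := hdom
  have hz : ψ z ≠ ⊤ := by
    intro h
    have := hv x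
    rw [h, EReal.top_add_coe] at this
    exact hx.not_ge this
  rcases eq_or_ne ε 0 with rfl | hε0
  · refine ⟨0, by simp [scaledFun, effDom, lt_top_iff_ne_top, hz], fun y => ?_⟩
    by_cases hy : y ∈ effDom ψ <;> simp [scaledFun, hy]
  · have hpos : 0 < ε := lt_of_le_of_ne hε hε0.symm
    obtain ⟨r, hr⟩ : ∃ r : ℝ, ψ z = r := ⟨_, (EReal.coe_toReal hz (hbot z)).symm⟩
    refine ⟨ε * r, by simp [scaledFun, hε0, hr], fun y => ?_⟩
    have hy := hv y
    rw [hr, ← EReal.coe_add] at hy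
    rw [scaledFun, if_neg hε0, ← mul_add, EReal.coe_mul]
    exact mul_le_mul_of_nonneg_left hy (by exact_mod_cast hε)

lemma mem_regSol_of_sub_smul_mem (hbot : ∀ x, ψ x ≠ ⊥) (hdom : (effDom ψ).Nonempty) (hε : 0 ≤ ε)
    (hz : z ∈ Q) (hv : v ∈ subdifferential ψ z) (h : g - ε • v ∈ normalCone Q z) :
    z ∈ regSol Q ψ ε g := by
  obtain ⟨r, hr, hy⟩ := exists_scaledFun_eq_coe hbot hdom hε hv
  refine ⟨hz, isMinOn_iff.2 fun y hyQ => ?_⟩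
  refine le_trans ?_ (add_le_add_right (hy y) _)
  rw [hr, ← EReal.coe_add, ← EReal.coe_add, EReal.coe_le_coe_iff]
  have := h y hyQ
  rw [inner_sub_left, real_inner_smul_left, inner_sub_right g] at this
  linarith

lemma regSol_subset_singleton (hbot : ∀ x, ψ x ≠ ⊥) (hdom : (effDom ψ).Nonempty) (hε : 0 ≤ ε)
    (hz : z ∈ Q) (hv : v ∈ subdifferential ψ z)
    (h : ∀ y ∈ Q, y ≠ z → inner ℝ (g - ε • v) (y - z) < 0) :
    regSol Q ψ ε g ⊆ {z} := by
  obtain ⟨r, hr, hy⟩ := exists_scaledFun_eq_coe hbot hdom hε hv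
  rintro x ⟨hxQ, hx⟩
  by_contra hxz
  have h1 := (add_le_add_right (hy x) ((-(inner ℝ g x : ℝ) : ℝ) : EReal)).trans
    (isMinOn_iff.1 hx z hz)
  rw [hr, ← EReal.coe_add, ← EReal.coe_add, EReal.coe_le_coe_iff] at h1
  have := h x hxQ hxz
  rw [inner_sub_left, real_inner_smul_left, inner_sub_right g] at this
  linarith

lemma ofReal_le_regThreshold (hbot : ∀ x, ψ x ≠ ⊥) (hdom : (effDom ψ).Nonempty) (hε : 0 ≤ ε)
    (hl : lpSol Q g = {z}) (hv : v ∈ subdifferential ψ z) (h : g - ε • v ∈ normalCone Q z) :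
    ENNReal.ofReal ε ≤ regThreshold Q ψ g := by
  have hzQ : z ∈ Q := (mem_vertices_of_lpSol_eq hl).1
  refine le_sSup ⟨ε, ⟨hε, fun ε' hε' => ?_⟩, rfl⟩
  rw [hl]
  refine regSol_subset_singleton hbot hdom hε'.1 hzQ hv fun y hy hyz => ?_
  have h1 := inner_sub_neg_of_lpSol_eq hl hy hyz
  have h2 := h y hy
  rw [inner_sub_left, real_inner_smul_left] at h2 ⊢
  have hlt := hε'.2
  have h0 := hε'.1
  -- g - ε'v is a convex combination of g and g - εv with positive weight on g, whose pairing with y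
  -- - z is strictly negative.
  rcases le_or_gt (inner ℝ v (y - z)) 0 with hi | hi
  · nlinarith
  · nlinarith

/-- Each comparison with a point y is affine in g if both regularizer values are finite, and
independent of g otherwise. -/
lemma isClosed_setOf_mem_regSol (hz : z ∈ Q) : IsClosed {g | z ∈ regSol Q ψ ε g} := by
  have key : ∀ (c d : EReal) (y : EuclideanSpace ℝ ι), IsClosed {g : EuclideanSpace ℝ ι |
      ((-(inner ℝ g z : ℝ) : ℝ) : EReal) + c ≤ ((-(inner ℝ g y : ℝ) : ℝ) : EReal) + d} := by
    intro c d y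
    induction c with
    | bot => simp
    | top => induction d with
      | bot => simp
      | top => simp
      | coe d =>
        have h (r : ℝ) : ¬ (⊤ : EReal) ≤ (r : EReal) + d := by
          rw [← EReal.coe_add]; exact not_le.2 (EReal.coe_lt_top _)
        simp only [EReal.coe_add_top, h, Set.ofPred_false, isClosed_empty]
    | coe c => induction d with
      | bot => simp
      | top => simp
      | coe d =>
        simp only [← EReal.coe_add, EReal.coe_le_coe_iff]
        exact isClosed_le (by fun_prop) (by fun_prop)
  have : {g | z ∈ regSol Q ψ ε g} = ⋂ y ∈ Q, {g : EuclideanSpace ℝ ι |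
      ((-(inner ℝ g z : ℝ) : ℝ) : EReal) + scaledFun ε ψ z ≤
        ((-(inner ℝ g y : ℝ) : ℝ) : EReal) + scaledFun ε ψ y} := by
    ext g
    simp [regSol, hz, isMinOn_iff]
  rw [this]
  exact isClosed_biInter fun y _ => key _ _ y

lemma measurableSet_exactReg_inter_smoothCosts (hQ : IsCompact Q) (hV : (vertices Q).Countable) :
    MeasurableSet (exactReg Q ψ ε ∩ smoothCosts Q) := by
  have : exactReg Q ψ ε ∩ smoothCosts Q =
      (⋃ z ∈ vertices Q, normalCone Q z ∩ {g | z ∈ regSol Q ψ ε g}) ∩ smoothCosts Q := by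
    ext g
    simp only [Set.mem_inter_iff, Set.mem_iUnion, exactReg, Set.mem_ofPred_eq]
    refine and_congr_left fun hg => ⟨fun ⟨z, hl, hz⟩ => ?_, fun ⟨z, hz, hn, hr⟩ => ?_⟩
    · have hzv := mem_vertices_of_lpSol_eq hl
      exact ⟨z, hzv, (mem_lpSol_iff_mem_normalCone hzv.1).1 (hl ▸ rfl), hz⟩
    · exact ⟨z, lpSol_eq_singleton hQ hg ((mem_lpSol_iff_mem_normalCone hz.1).2 hn), hr⟩
  rw [this]
  refine (MeasurableSet.biUnion hV fun z hz => ?_).inter measurableSet_smoothCosts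
  exact ((isClosed_normalCone Q z).inter (isClosed_setOf_mem_regSol hz.1)).measurableSet

end Geometry

/-! ### Failure probability and mean threshold. -/

section Probability

variable {ι : Type*} [Fintype ι] {Q : Set (EuclideanSpace ℝ ι)}
  {v : EuclideanSpace ℝ ι → EuclideanSpace ℝ ι} {ψ : EuclideanSpace ℝ ι → EReal} {ε B : ℝ}

/-- The smooth cost vectors `g` with `g - ε v_z` in the normal cone at some vertex `z`. -/
def shiftedCosts (Q : Set (EuclideanSpace ℝ ι)) (v : EuclideanSpace ℝ ι → EuclideanSpace ℝ ι)
    (ε : ℝ) : Set (EuclideanSpace ℝ ι) :=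
  ⋃ z ∈ vertices Q, smoothCosts Q ∩ {g | g - ε • v z ∈ normalCone Q z}

/-- Joint measurability in (g, ε) is what Tonelli needs. -/
lemma measurableSet_shiftedCosts_prod (hV : (vertices Q).Countable) :
    MeasurableSet {p : EuclideanSpace ℝ ι × ℝ | p.1 ∈ shiftedCosts Q v p.2} := by
  have : {p : EuclideanSpace ℝ ι × ℝ | p.1 ∈ shiftedCosts Q v p.2} =
      ⋃ z ∈ vertices Q, (Prod.fst ⁻¹' smoothCosts Q) ∩
        (fun p : EuclideanSpace ℝ ι × ℝ => p.1 - p.2 • v z) ⁻¹' normalCone Q z := by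
    ext p; simp [shiftedCosts]
  rw [this]
  refine MeasurableSet.biUnion hV fun z _ => (measurable_fst measurableSet_smoothCosts).inter ?_
  exact ((isClosed_normalCone Q z).preimage (by fun_prop)).measurableSet

lemma lpSol_eq_of_mem_shifted (hQ : IsCompact Q) (hε : 0 ≤ ε)
    {z g : EuclideanSpace ℝ ι} (hz : z ∈ vertices Q) (hv : v z ∈ normalCone Q z)
    (hg : g ∈ smoothCosts Q) (h : g - ε • v z ∈ normalCone Q z) : lpSol Q g = {z} :=
  lpSol_eq_singleton hQ hg
    ((mem_lpSol_iff_mem_normalCone hz.1).2 (mem_normalCone_of_sub_smul_mem hε hv h))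

lemma pairwiseDisjoint_normalCone_inter_smoothCosts (hQ : IsCompact Q) :
    (vertices Q).PairwiseDisjoint fun z => normalCone Q z ∩ smoothCosts Q := by
  intro z hz w hw hzw
  refine Set.disjoint_left.2 fun g ⟨hg, hgD⟩ ⟨hg', _⟩ => hzw ?_
  have h1 := lpSol_eq_singleton hQ hgD ((mem_lpSol_iff_mem_normalCone hz.1).2 hg)
  have h2 := (mem_lpSol_iff_mem_normalCone hw.1).2 hg'
  rw [h1] at h2
  exact h2.symm

lemma exp_le_stdGaussian_shiftedCosts (hQ : IsCompact Q) (hne : Q.Nonempty)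
    (hV : (vertices Q).Countable) (hv : ∀ z ∈ vertices Q, v z ∈ normalCone Q z)
    (hB : 0 ≤ B) (hvB : ∀ z ∈ vertices Q, ‖v z‖ ≤ B) (hε : 0 ≤ ε) :
    ENNReal.ofReal (Real.exp (-(1 / 2) * ε ^ 2 * B ^ 2 - ε * B * √(Fintype.card ι))) ≤
      stdGaussian (EuclideanSpace ℝ ι) (shiftedCosts Q v ε) := by
  set γ := stdGaussian (EuclideanSpace ℝ ι)
  set f : EuclideanSpace ℝ ι → ENNReal := fun x =>
    ENNReal.ofReal (Real.exp (-(1 / 2) * ε ^ 2 * B ^ 2 - ε * B * ‖x‖))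
  have hD := ae_mem_smoothCosts hQ hne
  have hNm (z : EuclideanSpace ℝ ι) : MeasurableSet (normalCone Q z) :=
    (isClosed_normalCone Q z).measurableSet
  have hcover : ∀ᵐ g ∂γ, g ∈ ⋃ z ∈ vertices Q, normalCone Q z ∩ smoothCosts Q := by
    filter_upwards [hD] with g hg
    obtain ⟨z, hz⟩ := lpSol_nonempty hQ hne g
    have hzv := mem_vertices_of_lpSol_eq (lpSol_eq_singleton hQ hg hz)
    exact Set.mem_biUnion hzv ⟨(mem_lpSol_iff_mem_normalCone hzv.1).1 hz, hg⟩
  calc ENNReal.ofReal (Real.exp (-(1 / 2) * ε ^ 2 * B ^ 2 - ε * B * √(Fintype.card ι)))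
      ≤ ∫⁻ x, f x ∂γ := by
        have h := exp_le_lintegral_stdGaussian (E := EuclideanSpace ℝ ι)
          (-(1 / 2) * ε ^ 2 * B ^ 2) (mul_nonneg hε hB)
        rwa [finrank_euclideanSpace] at h
    _ = ∫⁻ x in ⋃ z ∈ vertices Q, normalCone Q z ∩ smoothCosts Q, f x ∂γ := by
        rw [Measure.restrict_eq_self_of_ae_mem hcover]
    _ = ∑' z : vertices Q, ∫⁻ x in normalCone Q z ∩ smoothCosts Q, f x ∂γ :=
        lintegral_biUnion hV (fun z _ => (hNm z).inter measurableSet_smoothCosts)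
          (pairwiseDisjoint_normalCone_inter_smoothCosts hQ) _
    _ ≤ ∑' z : vertices Q, γ (smoothCosts Q ∩ {g | g - ε • v z ∈ normalCone Q z}) := by
        refine ENNReal.tsum_le_tsum fun z => ?_
        have h1 : γ (smoothCosts Q ∩ {g | g - ε • v z ∈ normalCone Q z}) =
            γ {g | g - ε • v z ∈ normalCone Q z} := by
          refine measure_congr ?_
          filter_upwards [hD] with g hg
          exact propext (and_iff_right hg)
        -- Compare the Cameron–Martin weight with `f` by Cauchy–Schwarz.
        rw [h1, stdGaussian_preimage_sub_const _ (hNm z)]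
        refine (lintegral_mono_set Set.inter_subset_left).trans (lintegral_mono fun x => ?_)
        refine ENNReal.ofReal_le_ofReal (Real.exp_le_exp.2 ?_)
        have hz := hvB z z.2
        have h2 : ‖ε • v z‖ ≤ ε * B := by
          rw [norm_smul, Real.norm_of_nonneg hε]
          exact mul_le_mul_of_nonneg_left hz hε
        have h3 : ‖ε • v z‖ ^ 2 ≤ (ε * B) ^ 2 := pow_le_pow_left₀ (norm_nonneg _) h2 2
        have h4 : inner ℝ x (ε • v z) ≤ ε * B * ‖x‖ :=
          (real_inner_le_norm _ _).trans <| by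
            rw [mul_comm]; exact mul_le_mul_of_nonneg_right h2 (norm_nonneg _)
        linarith [mul_pow ε B 2]
    _ = γ (shiftedCosts Q v ε) := by
        refine (measure_biUnion (μ := γ)
          (f := fun z => smoothCosts Q ∩ {g | g - ε • v z ∈ normalCone Q z}) hV
          (fun z hz w hw hzw => ?_) fun z _ => ?_).symm
        · refine (pairwiseDisjoint_normalCone_inter_smoothCosts hQ hz hw hzw).mono ?_ ?_
          · exact fun g hg => ⟨mem_normalCone_of_sub_smul_mem hε (hv z hz) hg.2, hg.1⟩
          · exact fun g hg => ⟨mem_normalCone_of_sub_smul_mem hε (hv w hw) hg.2, hg.1⟩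
        · exact measurableSet_smoothCosts.inter
            ((hNm z).preimage (measurable_id.sub_const _))

variable {Ω : Type*} [MeasurableSpace Ω] {P : Measure Ω}
  {g : Ω → EuclideanSpace ℝ ι}

lemma ae_comp_mem_smoothCosts (hQ : IsCompact Q) (hne : Q.Nonempty)
    (hg : HasLaw g (stdGaussian (EuclideanSpace ℝ ι)) P) : ∀ᵐ ω ∂P, g ω ∈ smoothCosts Q := by
  have := ae_mem_smoothCosts hQ hne
  rw [← hg.map_eq] at this
  exact ae_of_ae_map hg.aemeasurable this

theorem nullMeasurableSet_exactReg (hQ : IsCompact Q) (hne : Q.Nonempty)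
    (hV : (vertices Q).Countable) (hg : HasLaw g (stdGaussian (EuclideanSpace ℝ ι)) P) :
    NullMeasurableSet {ω | g ω ∈ exactReg Q ψ ε} P := by
  refine (hg.aemeasurable.nullMeasurableSet_preimage
    (measurableSet_exactReg_inter_smoothCosts (ψ := ψ) (ε := ε) hQ hV)).congr ?_
  filter_upwards [ae_comp_mem_smoothCosts hQ hne hg] with ω hω
  exact propext (and_iff_left hω)

theorem measureReal_not_mem_exactReg_le [IsProbabilityMeasure P]
    (hQ : IsCompact Q) (hne : Q.Nonempty) (hV : (vertices Q).Countable)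
    (hbot : ∀ x, ψ x ≠ ⊥) (hdom : (effDom ψ).Nonempty)
    (hv : ∀ z ∈ vertices Q, v z ∈ subdifferential ψ z ∩ normalCone Q z)
    (hB : 0 ≤ B) (hvB : ∀ z ∈ vertices Q, ‖v z‖ ≤ B) (hε : 0 ≤ ε)
    (hg : HasLaw g (stdGaussian (EuclideanSpace ℝ ι)) P) :
    P.real {ω | g ω ∉ exactReg Q ψ ε} ≤
      1 - Real.exp (-(1 / 2) * ε ^ 2 * B ^ 2 - ε * B * √(Fintype.card ι)) := by
  have hsub : shiftedCosts Q v ε ⊆ exactReg Q ψ ε := by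
    intro g hg
    simp only [shiftedCosts, Set.mem_iUnion] at hg
    obtain ⟨z, hz, hgD, hgz⟩ := hg
    exact ⟨z, lpSol_eq_of_mem_shifted hQ hε hz (hv z hz).2 hgD hgz,
      mem_regSol_of_sub_smul_mem hbot hdom hε hz.1 (hv z hz).1 hgz⟩
  have hm : MeasurableSet (shiftedCosts Q v ε) :=
    measurable_prodMk_right (measurableSet_shiftedCosts_prod (v := v) hV)
  have h1 := exp_le_stdGaussian_shiftedCosts hQ hne hV (fun z hz => (hv z hz).2) hB hvB hε
  have h2 : stdGaussian (EuclideanSpace ℝ ι) (shiftedCosts Q v ε) ≤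
      P {ω | g ω ∈ exactReg Q ψ ε} := by
    rw [← hg.map_eq, Measure.map_apply_of_aemeasurable hg.aemeasurable hm]
    exact measure_mono fun ω hω => hsub hω
  have h3 := (ENNReal.ofReal_le_iff_le_toReal (measure_ne_top _ _)).1 (h1.trans h2)
  have h4 := probReal_compl_eq_one_sub₀
    (nullMeasurableSet_exactReg (ψ := ψ) (ε := ε) hQ hne hV hg)
  rw [Measure.real, Measure.real] at h4
  change (P {ω | g ω ∈ exactReg Q ψ ε}ᶜ).toReal ≤ _
  linarith

lemma one_sub_exp_div_le_lintegral (hB : 0 ≤ B) (n : ℕ) :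
    ENNReal.ofReal (1 - Real.exp (-4 * n)) / ENNReal.ofReal (2 * B * √n) ≤
      ∫⁻ ε in Set.Ici 0, ENNReal.ofReal (Real.exp (-(1 / 2) * ε ^ 2 * B ^ 2 - ε * B * √n)) := by
  -- For n = 0 the quotient is 0 / 0 = 0; for B = 0 < n both sides are infinite.
  rcases n.eq_zero_or_pos with rfl | hn
  · simp
  rcases hB.eq_or_lt with rfl | hB
  · simp
  have hs : 0 < √(n : ℝ) := by positivity
  have hs2 : √(n : ℝ) * √n = n := Real.mul_self_sqrt (by positivity)
  set s := √(n : ℝ)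
  -- Up to `R` the quadratic term ε²B²/2 is at most the linear term εBs, so the exponent is at least
  -- -2Bsε, which equals -4n at `R`.
  set R := 2 * s / B
  have hR : 0 ≤ R := by positivity
  have hBR : B * R = 2 * s := by simp only [R]; field_simp
  calc ENNReal.ofReal (1 - Real.exp (-4 * n)) / ENNReal.ofReal (2 * B * s)
      = ENNReal.ofReal (∫ x in (0 : ℝ)..R, Real.exp ((-(2 * B * s)) * x)) := by
        rw [← ENNReal.ofReal_div_of_pos (by positivity),
          intervalIntegral.integral_comp_mul_left (fun x => Real.exp x) (by nlinarith),
          integral_exp]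
        congr 1
        have : -(2 * B * s) * R = -4 * n := by
          rw [← hs2]; linear_combination (-2 * s) * hBR
        rw [this, mul_zero, Real.exp_zero, smul_eq_mul]
        field_simp
        ring
    _ = ∫⁻ x in Set.Ioc 0 R, ENNReal.ofReal (Real.exp ((-(2 * B * s)) * x)) := by
        rw [intervalIntegral.integral_of_le hR]
        refine ofReal_integral_eq_lintegral_ofReal ?_ (ae_of_all _ fun x => (Real.exp_pos _).le)
        exact (Continuous.integrableOn_Icc (by fun_prop)).mono_set Set.Ioc_subset_Icc_self
    _ ≤ ∫⁻ ε in Set.Ioc 0 R,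
          ENNReal.ofReal (Real.exp (-(1 / 2) * ε ^ 2 * B ^ 2 - ε * B * s)) := by
        refine setLIntegral_mono (by fun_prop) fun x hx => ?_
        refine ENNReal.ofReal_le_ofReal (Real.exp_le_exp.2 ?_)
        have h1 : B * x ≤ 2 * s := hBR ▸ mul_le_mul_of_nonneg_left hx.2 hB.le
        have h2 := mul_le_mul_of_nonneg_left h1 (mul_nonneg hB.le hx.1.le)
        nlinarith
    _ ≤ _ := lintegral_mono_set fun x hx => hx.1.le

theorem one_sub_exp_div_le_lintegral_regThreshold (hQ : IsCompact Q) (hne : Q.Nonempty)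
    (hV : (vertices Q).Countable) (hbot : ∀ x, ψ x ≠ ⊥) (hdom : (effDom ψ).Nonempty)
    (hv : ∀ z ∈ vertices Q, v z ∈ subdifferential ψ z ∩ normalCone Q z)
    (hB : 0 ≤ B) (hvB : ∀ z ∈ vertices Q, ‖v z‖ ≤ B)
    (hg : HasLaw g (stdGaussian (EuclideanSpace ℝ ι)) P) :
    ENNReal.ofReal (1 - Real.exp (-4 * Fintype.card ι)) /
        ENNReal.ofReal (2 * B * √(Fintype.card ι)) ≤
      ∫⁻ ω, regThreshold Q ψ (g ω) ∂P := by
  set γ := stdGaussian (EuclideanSpace ℝ ι)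
  set S := {p : EuclideanSpace ℝ ι × ℝ | p.1 ∈ shiftedCosts Q v p.2}
  have hS : MeasurableSet S := measurableSet_shiftedCosts_prod hV
  have hF : Measurable (S.indicator (1 : EuclideanSpace ℝ ι × ℝ → ENNReal)) :=
    measurable_one.indicator hS
  calc _ ≤ ∫⁻ ε in Set.Ici 0, ENNReal.ofReal
          (Real.exp (-(1 / 2) * ε ^ 2 * B ^ 2 - ε * B * √(Fintype.card ι))) :=
        one_sub_exp_div_le_lintegral hB _
    _ ≤ ∫⁻ ε in Set.Ici (0 : ℝ), ∫⁻ x, S.indicator 1 (x, ε) ∂γ := by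
        refine setLIntegral_mono' measurableSet_Ici fun ε hε => ?_
        refine (exp_le_stdGaussian_shiftedCosts hQ hne hV (fun z hz => (hv z hz).2)
          hB hvB hε).trans_eq ?_
        exact (lintegral_indicator_one (measurable_prodMk_right hS :
          MeasurableSet (shiftedCosts Q v ε))).symm
    _ = ∫⁻ x, (∫⁻ ε in Set.Ici (0 : ℝ), S.indicator 1 (x, ε)) ∂γ :=
        lintegral_lintegral_swap (f := fun ε x => S.indicator 1 (x, ε))
          (hF.comp measurable_swap).aemeasurable
    _ = ∫⁻ ω, (∫⁻ ε in Set.Ici (0 : ℝ), S.indicator 1 (g ω, ε)) ∂P := by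
        rw [← hg.map_eq]
        exact lintegral_map' hF.lintegral_prod_right'.aemeasurable hg.aemeasurable
    -- Pointwise, the admissible ε form a subset of [0, threshold], so their length is at most the
    -- threshold; its measurability is not needed.
    _ ≤ ∫⁻ ω, regThreshold Q ψ (g ω) ∂P := by
        refine lintegral_mono fun ω => ?_
        set T := {ε : ℝ | g ω ∈ shiftedCosts Q v ε}
        have hT : MeasurableSet T := measurable_prodMk_left hS
        calc ∫⁻ ε in Set.Ici (0 : ℝ), S.indicator 1 (g ω, ε)
            = volume (T ∩ Set.Ici 0) := by
              rw [← Measure.restrict_apply hT, ← lintegral_indicator_one hT]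
              rfl
          _ ≤ regThreshold Q ψ (g ω) := by
              have hle : ∀ ε ∈ T ∩ Set.Ici 0, ENNReal.ofReal ε ≤ regThreshold Q ψ (g ω) := by
                rintro ε ⟨hεT, hε⟩
                simp only [T, shiftedCosts, Set.mem_ofPred_eq, Set.mem_iUnion] at hεT
                obtain ⟨z, hz, hgD, hgz⟩ := hεT
                exact ofReal_le_regThreshold hbot hdom hε
                  (lpSol_eq_of_mem_shifted hQ hε hz (hv z hz).2 hgD hgz) (hv z hz).1 hgz
              rcases eq_or_ne (regThreshold Q ψ (g ω)) ⊤ with h | h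
              · simp [h]
              have : T ∩ Set.Ici 0 ⊆ Set.Icc 0 (regThreshold Q ψ (g ω)).toReal :=
                fun ε hε => ⟨hε.2, (ENNReal.ofReal_le_iff_le_toReal h).1 (hle ε hε)⟩
              refine (measure_mono this).trans ?_
              simp [ENNReal.ofReal_toReal h]

end Probability

/-! ### Finiteness of the vertex set. -/

section Polyhedron

variable {κ ι : Type*} [Fintype ι]

lemma isClosed_polyhedron (A : Matrix κ ι ℝ) (b : κ → ℝ) : IsClosed (polyhedron A b) := by
  simp only [polyhedron, Pi.le_def, Set.ofPred_forall]
  refine isClosed_iInter fun i => isClosed_le ?_ continuous_const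
  simp only [Matrix.mulVec, dotProduct]
  fun_prop

/-- A vertex of a polyhedron is determined by its active constraints. -/
lemma finite_vertices_polyhedron [Finite κ] (A : Matrix κ ι ℝ) (b : κ → ℝ) :
    (vertices (polyhedron A b)).Finite := by
  refine Set.Finite.of_finite_image (f := fun z => {i | A.mulVec z.ofLp i = b i})
    (Set.toFinite _) ?_
  rintro z ⟨hz, l, hl⟩ w ⟨hw, -⟩ (hzw : {i | _} = {i | _})
  -- With equal active sets, a small step from z away from w stays feasible. Optimality of z for `l`
  -- then gives l w ≥ l z, and exposedness gives w = z.
  have hev : ∀ᶠ t : ℝ in nhdsWithin 0 (Set.Ioi 0), z - t • (w - z) ∈ polyhedron A b := by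
    have : ∀ i, ∀ᶠ t : ℝ in nhdsWithin 0 (Set.Ioi 0),
        A.mulVec z.ofLp i - t * (A.mulVec w.ofLp i - A.mulVec z.ofLp i) ≤ b i := by
      intro i
      by_cases hi : A.mulVec z.ofLp i = b i
      · have hi' : A.mulVec w.ofLp i = b i := (Set.ext_iff.1 hzw i).1 hi
        exact Filter.Eventually.of_forall fun t => by simp [hi, hi']
      · refine nhdsWithin_le_nhds ?_
        have hlt : A.mulVec z.ofLp i < b i := lt_of_le_of_ne (hz i) hi
        have hc : Continuous fun t : ℝ =>
          A.mulVec z.ofLp i - t * (A.mulVec w.ofLp i - A.mulVec z.ofLp i) := by fun_prop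
        have h0 := (hc.tendsto 0).eventually_lt_const (u := b i) (by simpa using hlt)
        exact h0.mono fun t ht => ht.le
    filter_upwards [Filter.eventually_all.2 this] with t ht i
    simpa [Matrix.mulVec_sub, Matrix.mulVec_smul] using ht i
  obtain ⟨t, ht, ht0⟩ := (hev.and self_mem_nhdsWithin).exists
  have h1 := (hl _ ht).1
  rw [map_sub, map_smul, map_sub, smul_eq_mul] at h1
  refine ((hl w hw).2 ?_).symm
  by_contra! hlt
  nlinarith [mul_pos (Set.mem_Ioi.1 ht0) (sub_pos.2 hlt)]

end Polyhedron

/-! ### The Birkhoff polytope with the quadratic regularizer. -/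

section Birkhoff

variable {d : ℕ}

/-- The identification of `d × d` matrices with vectors indexed by pairs. -/
noncomputable def matrixToVec (d : ℕ) :
    Matrix (Fin d) (Fin d) ℝ →ₗ[ℝ] EuclideanSpace ℝ (Fin d × Fin d) where
  toFun M := WithLp.toLp 2 fun p => M p.1 p.2
  map_add' _ _ := rfl
  map_smul' _ _ := rfl

lemma birkhoffPolytope_eq_convexHull :
    birkhoffPolytope d = convexHull ℝ
      (Set.range fun σ : Equiv.Perm (Fin d) => matrixToVec d (σ.permMatrix ℝ)) := by
  have h1 : birkhoffPolytope d = matrixToVec d '' doublyStochastic ℝ (Fin d) := by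
    ext X
    constructor
    · rintro ⟨hr, hc, h0⟩
      exact ⟨fun i j => X (i, j), mem_doublyStochastic_iff_sum.2 ⟨h0, hr, hc⟩, rfl⟩
    · rintro ⟨M, hM, rfl⟩
      obtain ⟨h0, hr, hc⟩ := mem_doublyStochastic_iff_sum.1 hM
      exact ⟨hr, hc, h0⟩
  rw [h1, doublyStochastic_eq_convexHull_permMatrix, LinearMap.image_convexHull]
  congr 1
  ext X
  simp

lemma isCompact_birkhoffPolytope : IsCompact (birkhoffPolytope d) := by
  rw [birkhoffPolytope_eq_convexHull]
  exact (Set.finite_range _).isCompact_convexHull ℝ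

lemma birkhoffPolytope_nonempty : (birkhoffPolytope d).Nonempty := by
  rw [birkhoffPolytope_eq_convexHull]
  exact (Set.range_nonempty _).convexHull

/-- Exposed points are extreme, and extreme points of a hull are among its generators. -/
lemma vertices_birkhoffPolytope_subset : vertices (birkhoffPolytope d) ⊆
    Set.range fun σ : Equiv.Perm (Fin d) => matrixToVec d (σ.permMatrix ℝ) := by
  refine (exposedPoints_subset_extremePoints (𝕜 := ℝ)).trans ?_
  rw [birkhoffPolytope_eq_convexHull]
  exact extremePoints_convexHull_subset (𝕜 := ℝ)

lemma sum_eq_of_mem_birkhoffPolytope {X : EuclideanSpace ℝ (Fin d × Fin d)}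
    (hX : X ∈ birkhoffPolytope d) : ∑ p, X p = d := by
  rw [Fintype.sum_prod_type]
  simp [hX.1]

lemma norm_sq_le_of_mem_birkhoffPolytope {X : EuclideanSpace ℝ (Fin d × Fin d)}
    (hX : X ∈ birkhoffPolytope d) : ‖X‖ ^ 2 ≤ d := by
  rw [EuclideanSpace.real_norm_sq_eq, ← sum_eq_of_mem_birkhoffPolytope hX]
  refine Finset.sum_le_sum fun ⟨i, j⟩ _ => ?_
  have h0 := hX.2.2 i j
  have h1 : X (i, j) ≤ 1 := by
    rw [← hX.1 i]
    exact Finset.single_le_sum (f := fun j => X (i, j)) (fun k _ => hX.2.2 i k)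
      (Finset.mem_univ j)
  nlinarith

lemma norm_sq_of_mem_vertices_birkhoffPolytope {X : EuclideanSpace ℝ (Fin d × Fin d)}
    (hX : X ∈ vertices (birkhoffPolytope d)) : ‖X‖ ^ 2 = d := by
  rw [EuclideanSpace.real_norm_sq_eq, ← sum_eq_of_mem_birkhoffPolytope hX.1]
  obtain ⟨σ, rfl⟩ := vertices_birkhoffPolytope_subset hX
  refine Finset.sum_congr rfl fun ⟨i, j⟩ _ => ?_
  have h (x : ℝ) (hx : x = 1 ∨ x = 0) : x ^ 2 = x := by rcases hx with rfl | rfl <;> norm_num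
  refine h (σ.permMatrix ℝ i j) ?_
  exact ite_eq_or_eq _ _ _

lemma mem_subdifferential_quadReg {ι : Type*} [Fintype ι] (z : EuclideanSpace ℝ ι) :
    z ∈ subdifferential quadReg z := fun y => by
  rw [quadReg, quadReg, ← EReal.coe_add, EReal.coe_le_coe_iff, inner_sub_right,
    real_inner_self_eq_norm_sq]
  have h := norm_sub_sq_real z y
  nlinarith [sq_nonneg ‖z - y‖]

/-- Vertices are the points of largest norm: 2⟨z, y⟩ ≤ ‖z‖² + ‖y‖² ≤ 2‖z‖². -/
lemma mem_normalCone_birkhoffPolytope {z : EuclideanSpace ℝ (Fin d × Fin d)}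
    (hz : z ∈ vertices (birkhoffPolytope d)) : z ∈ normalCone (birkhoffPolytope d) z := by
  intro y hy
  rw [inner_sub_right, real_inner_self_eq_norm_sq]
  have h := norm_sub_sq_real z y
  have h1 := norm_sq_le_of_mem_birkhoffPolytope hy
  have h2 := norm_sq_of_mem_vertices_birkhoffPolytope hz
  nlinarith [sq_nonneg ‖z - y‖]

end Birkhoff

/-! ### The corollary and its application. -/

lemma one_sub_exp_neg_le (x : ℝ) : 1 - Real.exp (-x) ≤ x := by
  linarith [Real.one_sub_le_exp_neg x]

theorem mainTheorem5 {Ω : Type*} [MeasurableSpace Ω] (P : Measure Ω) [IsProbabilityMeasure P] :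
    (∀ (m n : ℕ) (A : Matrix (Fin m) (Fin n) ℝ) (b : Fin m → ℝ)
      (Q : Set (EuclideanSpace ℝ (Fin n))), Q = polyhedron A b → Q.Nonempty →
      Bornology.IsBounded Q →
      ∀ ψ : EuclideanSpace ℝ (Fin n) → EReal, IsProperConvex ψ →
      (intrinsicInterior ℝ (effDom ψ) ∩ Q).Nonempty →
      ∀ v : EuclideanSpace ℝ (Fin n) → EuclideanSpace ℝ (Fin n),
      (∀ z ∈ vertices Q, v z ∈ subdifferential ψ z ∩ normalCone Q z) →
      ∀ g : Ω → EuclideanSpace ℝ (Fin n), HasLaw g (stdGaussian (EuclideanSpace ℝ (Fin n))) P →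
      ∃ B : ℝ, IsGreatest ((fun z => ‖v z‖) '' vertices Q) B ∧
        (∀ ε : ℝ, 0 ≤ ε →
          NullMeasurableSet {ω | g ω ∈ exactReg Q ψ ε} P ∧
          P.real {ω | g ω ∉ exactReg Q ψ ε} ≤
            1 - Real.exp (-(1 / 2) * ε ^ 2 * B ^ 2 - ε * B * √n) ∧
          1 - Real.exp (-(1 / 2) * ε ^ 2 * B ^ 2 - ε * B * √n) ≤
            1 / 2 * ε ^ 2 * B ^ 2 + ε * B * √n) ∧
        ENNReal.ofReal (1 - Real.exp (-4 * n)) / ENNReal.ofReal (2 * B * √n) ≤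
          ∫⁻ ω, regThreshold Q ψ (g ω) ∂P) ∧
    (∀ (d n : ℕ), n = d ^ 2 →
      ∀ g : Ω → EuclideanSpace ℝ (Fin d × Fin d),
      HasLaw g (stdGaussian (EuclideanSpace ℝ (Fin d × Fin d))) P →
      (∀ ε : ℝ, 0 ≤ ε →
        P.real {ω | g ω ∉ exactReg (birkhoffPolytope d) quadReg ε} ≤
          1 - Real.exp (-(1 / 2) * ε ^ 2 * √n - ε * (n : ℝ) ^ (3 / 4 : ℝ)) ∧
        1 - Real.exp (-(1 / 2) * ε ^ 2 * √n - ε * (n : ℝ) ^ (3 / 4 : ℝ)) ≤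
          1 / 2 * ε ^ 2 * √n + ε * (n : ℝ) ^ (3 / 4 : ℝ)) ∧
      ENNReal.ofReal (1 - Real.exp (-4 * n)) / ENNReal.ofReal (2 * (n : ℝ) ^ (3 / 4 : ℝ)) ≤
        ∫⁻ ω, regThreshold (birkhoffPolytope d) quadReg (g ω) ∂P) := by
  refine ⟨?_, ?_⟩
  · intro m n A b Q hQA hne hbdd ψ hψ _ v hv g hg
    have hQ : IsCompact Q :=
      Metric.isCompact_of_isClosed_isBounded (hQA ▸ isClosed_polyhedron A b) hbdd
    have hfin : (vertices Q).Finite := hQA ▸ finite_vertices_polyhedron A b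
    -- A generic cost exposes a vertex, so the maximum defining B is over a nonempty finite set.
    have hVne : (vertices Q).Nonempty := by
      obtain ⟨x, hx⟩ := (ae_mem_smoothCosts hQ hne).exists
      obtain ⟨z, hz⟩ := lpSol_nonempty hQ hne x
      exact ⟨z, mem_vertices_of_lpSol_eq (lpSol_eq_singleton hQ hx hz)⟩
    obtain ⟨z₀, hz₀, hmax⟩ := hfin.exists_maximalFor (fun z => ‖v z‖) _ hVne
    have hle : ∀ z ∈ vertices Q, ‖v z‖ ≤ ‖v z₀‖ := fun z hz =>
      (le_total ‖v z‖ ‖v z₀‖).elim id (hmax hz)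
    refine ⟨‖v z₀‖, ⟨⟨z₀, hz₀, rfl⟩, Set.forall_mem_image.2 hle⟩, fun ε hε =>
      ⟨nullMeasurableSet_exactReg hQ hne hfin.countable hg, ?_, ?_⟩, ?_⟩
    · simpa only [Fintype.card_fin] using measureReal_not_mem_exactReg_le hQ hne hfin.countable
        hψ.ne_bot hψ.nonempty_effDom hv (norm_nonneg _) hle hε hg
    · convert one_sub_exp_neg_le _ using 3
      ring
    · simpa only [Fintype.card_fin] using one_sub_exp_div_le_lintegral_regThreshold hQ hne
        hfin.countable hψ.ne_bot hψ.nonempty_effDom hv (norm_nonneg _) hle hg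
  · intro d n hn g hg
    have hfin : (vertices (birkhoffPolytope d)).Finite :=
      (Set.finite_range _).subset vertices_birkhoffPolytope_subset
    have hcard : Fintype.card (Fin d × Fin d) = n := by simp [hn, sq]
    have hsqrt : √(n : ℝ) = d := by
      rw [hn]; push_cast; exact Real.sqrt_sq d.cast_nonneg
    have hB2 : √(d : ℝ) ^ 2 = √(n : ℝ) := by rw [hsqrt, Real.sq_sqrt d.cast_nonneg]
    have hBn : √(d : ℝ) * √(n : ℝ) = (n : ℝ) ^ (3 / 4 : ℝ) := by
      rw [hsqrt, hn, Nat.cast_pow, ← Real.rpow_natCast_mul d.cast_nonneg,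
        show ((2 : ℕ) : ℝ) * (3 / 4) = 1 / 2 + 1 by norm_num,
        Real.rpow_add_of_nonneg d.cast_nonneg (by norm_num) (by norm_num), Real.rpow_one,
        Real.sqrt_eq_rpow]
    have hbot (x : EuclideanSpace ℝ (Fin d × Fin d)) : quadReg x ≠ ⊥ := EReal.coe_ne_bot _
    have hdom : (effDom (quadReg (ι := Fin d × Fin d))).Nonempty := ⟨0, EReal.coe_lt_top _⟩
    have hv : ∀ z ∈ vertices (birkhoffPolytope d),
        id z ∈ subdifferential quadReg z ∩ normalCone (birkhoffPolytope d) z := fun z hz =>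
      ⟨mem_subdifferential_quadReg z, mem_normalCone_birkhoffPolytope hz⟩
    have hle : ∀ z ∈ vertices (birkhoffPolytope d), ‖id z‖ ≤ √(d : ℝ) := fun z hz =>
      Real.le_sqrt_of_sq_le (norm_sq_of_mem_vertices_birkhoffPolytope hz).le
    refine ⟨fun ε hε => ⟨?_, ?_⟩, ?_⟩
    · have h := measureReal_not_mem_exactReg_le isCompact_birkhoffPolytope
        birkhoffPolytope_nonempty hfin.countable hbot hdom hv (Real.sqrt_nonneg _) hle hε hg
      rwa [hcard, hB2, mul_assoc ε, hBn] at h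
    · convert one_sub_exp_neg_le _ using 3
      ring
    · have h := one_sub_exp_div_le_lintegral_regThreshold isCompact_birkhoffPolytope
        birkhoffPolytope_nonempty hfin.countable hbot hdom hv (Real.sqrt_nonneg _) hle hg
      rwa [hcard, mul_assoc 2, hBn] at h
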